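/- Conventions. Let $A$ be a finite set and $\pi\colon A^*\to M$ a homomorphism onto a monoid $M$. A \emph{regular combing} of $M$ (with respect to $\pi$) is a regular language $R\subseteq A^*$ with $\pi(R)=M$. With two new symbols $\#_1,\#_2\notin A$, put $$\mathcal T_M(R)=\{\,u\,\#_1\,v\,\#_2\,w^{\mathrm{rev}} \mid u,v,w\in R,\ \pi(u)\pi(v)=\pi(w)\,\},$$ where $w^{\mathrm{rev}}$ is $w$ read backwards. The monoid $M$ is \emph{word-hyperbolic with respect to the regular combing $R$} if $\mathcal T_M(R)$ is a context-free language; it is so \emph{with $1$-uniqueness} if moreover the empty word $\varepsilon$ is the only word of $R$ that represents $1\in M$, and \emph{without $1$-uniqueness} otherwise. The monoid $M$ is \emph{$\star$-word-hyperbolic} if, for some finite generating set, it is word-hyperbolic with respect to some regular combing $R$ with $R^*=R$. For languages $R_1\subseteq A_1^*$, $R_2\subseteq A_2^*$ over disjoint alphabets, $\mathrm{Alt}(R_1,R_2)\subseteq (A_1\cup A_2)^*$ is the set of all words $x_1x_2\cdots x_n$ ($n\ge 0$) in which every $x_i$ is a non-empty word of $R_1\cup R_2$ and, for $1\le i<n$,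 one of $x_i,x_{i+1}$ lies in $R_1$ and the other in $R_2$; in particular $\varepsilon\in\mathrm{Alt}(R_1,R_2)$. Proposition. Let $M_1,M_2$ be monoids generated by finite disjoint sets $A_1,A_2$ through $\pi_1\colon A_1^*\to M_1$ and $\pi_2\colon A_2^*\to M_2$. Suppose that $M_1$ and $M_2$ are word-hyperbolic without $1$-uniqueness with respect to regular combings $R_1\subseteq A_1^*$ and $R_2\subseteq A_2^*$ respectively, and that the monoid free product $M=M_1\ast M_2$, generated by $A_1\cup A_2$ through the homomorphism extending $\pi_1$ and $\pi_2$, is word-hyperbolic with respect to some regular combing $R\subseteq (A_1\cup A_2)^*$. If $\mathrm{Alt}(R_1,R_2)\subseteq R$, then $M_1$, $M_2$ and $M$ are all $\star$-word-hyperbolic. -/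

import Mathlib

open scoped Computability

namespace WordHyp

/-- The alphabet `A ∪ {#₁, #₂}`: the letters of `A` together with two new symbols. -/
inductive Marked (A : Type*) where
  | letter (a : A) : Marked A
  | hash₁ : Marked A
  | hash₂ : Marked A

/-- The value in `M` of a word over `A`, for a homomorphism `π : A* → M`. -/
def eval {A M : Type*} [Monoid M] (π : FreeMonoid A →* M) (w : List A) : M :=
  π (FreeMonoid.ofList w)

/-- The multiplication table `{ u #₁ v #₂ wʳᵉᵛ | u, v, w ∈ R, u · v = w in M }`. -/
def multTable {A M : Type*} [Monoid M] (π : FreeMonoid A →* M) (R : Language A) :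
    Language (Marked A) :=
  { x | ∃ u ∈ R, ∃ v ∈ R, ∃ w ∈ R, eval π u * eval π v = eval π w ∧
      x = u.map Marked.letter ++ [Marked.hash₁] ++ v.map Marked.letter ++ [Marked.hash₂] ++
        w.reverse.map Marked.letter }

/-- `R` is a regular combing of `M`: a regular language of words over the generators which
represents every element of `M` (in particular `π` is surjective). -/
structure IsRegularCombing {A M : Type*} [Monoid M] (π : FreeMonoid A →* M)
    (R : Language A) : Prop where
  regular : R.IsRegular
  surj : ∀ m : M, ∃ w ∈ R, eval π w = m

/-- `M`, generated by `A` through `π`, is word-hyperbolic with respect to `R`. -/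
structure IsWordHyperbolicWrt {A M : Type*} [Monoid M] (π : FreeMonoid A →* M)
    (R : Language A) : Prop where
  combing : IsRegularCombing π R
  contextFree : (multTable π R).IsContextFree

/-- `1`-uniqueness: the empty word is the only word of `R` which represents the identity. -/
def OneUnique {A M : Type*} [Monoid M] (π : FreeMonoid A →* M) (R : Language A) : Prop :=
  { w : List A | w ∈ R ∧ eval π w = 1 } = {[]}

/-- `M` is `⋆`-word-hyperbolic: for some finite generating set it is word-hyperbolic with respect
to a regular combing `R` with `R* = R`. -/
def IsStarWordHyperbolic (M : Type*) [Monoid M] : Prop :=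
  ∃ (A : Type) (_ : Finite A) (π : FreeMonoid A →* M) (R : Language A),
    IsWordHyperbolicWrt π R ∧ R∗ = R

/-- The word over the disjoint union `A₁ ⊕ A₂` given by a word over one of the two alphabets. -/
def embedWord {A₁ A₂ : Type*} : List A₁ ⊕ List A₂ → List (A₁ ⊕ A₂)
  | .inl u => u.map Sum.inl
  | .inr v => v.map Sum.inr

/-- A non-empty word of `R₁` or of `R₂`, with a record of which of the two. -/
def IsFactor {A₁ A₂ : Type*} (R₁ : Language A₁) (R₂ : Language A₂) :
    List A₁ ⊕ List A₂ → Prop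
  | .inl u => u ∈ R₁ ∧ u ≠ []
  | .inr v => v ∈ R₂ ∧ v ≠ []

/-- The language `Alt(R₁, R₂)` of alternating words: products `x₁ x₂ ⋯ xₙ` (`n ≥ 0`) of non-empty
words `xᵢ ∈ R₁ ∪ R₂` in which consecutive factors come from different languages.
The empty word is alternating (`n = 0`). -/
def alt {A₁ A₂ : Type*} (R₁ : Language A₁) (R₂ : Language A₂) : Language (A₁ ⊕ A₂) :=
  { w | ∃ xs : List (List A₁ ⊕ List A₂),
      (∀ x ∈ xs, IsFactor R₁ R₂ x) ∧
      xs.IsChain (fun x y => x.isLeft ≠ y.isLeft) ∧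
      w = (xs.map embedWord).flatten }

/-- The homomorphism `(A₁ ∪ A₂)* → M₁ ∗ M₂` onto the monoid free product that extends
`π₁ : A₁* → M₁` and `π₂ : A₂* → M₂`. -/
def freeProdHom {A₁ A₂ M₁ M₂ : Type*} [Monoid M₁] [Monoid M₂]
    (π₁ : FreeMonoid A₁ →* M₁) (π₂ : FreeMonoid A₂ →* M₂) :
    FreeMonoid (A₁ ⊕ A₂) →* Monoid.Coprod M₁ M₂ :=
  FreeMonoid.lift (Sum.elim
    (fun a => Monoid.Coprod.inl (π₁ (FreeMonoid.of a)))
    (fun b => Monoid.Coprod.inr (π₂ (FreeMonoid.of b))))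

end WordHyp

/-! Failure of 1-uniqueness gives, for each i, a non-empty word `e_i ∈ R_i` with value 1. This makes
empty syllables expressible: the language K of all products of blocks `u v`, with u and v non-empty
words of `R₁` and `R₂`, equals its own star, lies in `Alt(R₁, R₂)`, hence in R, and still represents
every element of M, since `u e₂` has the value of u and `e₁ v` that of v.

The table of a regular sublanguage K of R is the table of R intersected with the regular language of
marked triples over K, hence context-free (`multTable_eq_inf`). This settles M. For `M₁`, only
blocks `u e₂` are allowed: erasing the letters of `A₂` maps these words onto `R₁∗` without changing
their value, and `M₁` embeds in M, so the table of `R₁∗` is an erasing image of a context-free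
language (`IsWordHyperbolicWrt.of_filterMap`). `M₂` is symmetric. -/

namespace Language

/-! ### Closure properties of regular languages, by counting left quotients -/

variable {α β : Type*}

theorem mem_sSup {S : Set (Language α)} {w : List α} : w ∈ sSup S ↔ ∃ B ∈ S, w ∈ B :=
  Set.mem_sUnion

/-- By Myhill–Nerode: the quotient by x is `(x\L) M` together with all `z\M` for splittings x = yz
with y in L, so it is determined by one quotient of L and a set of quotients of M. -/
theorem IsRegular.mul {L M : Language α} (hL : L.IsRegular) (hM : M.IsRegular) :
    (L * M).IsRegular := by
  apply IsRegular.of_finite_range_leftQuotient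
  have h := hL.finite_range_leftQuotient.prod hM.finite_range_leftQuotient.powerset
  refine (h.image fun p : Language α × Set (Language α) =>
    p.1 * M + sSup p.2).subset ?_
  rintro _ ⟨x, rfl⟩
  refine ⟨(L.leftQuotient x, {B | ∃ y z, y ++ z = x ∧ y ∈ L ∧ M.leftQuotient z = B}),
    ⟨⟨x, rfl⟩, ?_⟩, ?_⟩
  · rintro _ ⟨y, z, -, -, rfl⟩
    exact ⟨z, rfl⟩
  · ext w
    rw [mem_add, mem_leftQuotient, mem_mul, mem_mul, mem_sSup]
    constructor
    · rintro (⟨a, ha, b, hb, rfl⟩ | ⟨_, ⟨y, z, rfl, hy, rfl⟩, hw⟩)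
      · exact ⟨x ++ a, ha, b, hb, by simp⟩
      · exact ⟨y, hy, z ++ w, hw, by simp⟩
    · rintro ⟨a, ha, b, hb, h⟩
      rcases List.append_eq_append_iff.1 h with ⟨z, rfl, rfl⟩ | ⟨z, rfl, rfl⟩
      · exact Or.inr ⟨_, ⟨a, z, rfl, ha, rfl⟩, hb⟩
      · exact Or.inl ⟨z, ha, b, hb, rfl⟩

theorem append_mem_kstar {L : Language α} {x y : List α} (hx : x ∈ L∗) (hy : y ∈ L∗) :
    x ++ y ∈ L∗ := by
  have := append_mem_mul hx hy
  rwa [kstar_mul_kstar] at this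

theorem mem_kstar_of_mem {L : Language α} {x : List α} (hx : x ∈ L) : x ∈ L∗ :=
  (le_kstar : L ≤ L∗) hx

@[elab_as_elim]
theorem kstar_induction {L : Language α} {p : ∀ w, w ∈ L∗ → Prop} (nil : p [] (nil_mem_kstar L))
    (append : ∀ x (hx : x ∈ L) y (hy : y ∈ L∗), p y hy →
      p (x ++ y) (append_mem_kstar (mem_kstar_of_mem hx) hy))
    {w : List α} (hw : w ∈ L∗) : p w hw := by
  obtain ⟨l, rfl, hl⟩ := mem_kstar.1 hw
  induction l with
  | nil => exact nil
  | cons x l ih =>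
    have hl' : ∀ y ∈ l, y ∈ L := fun y hy => hl y (List.mem_cons_of_mem _ hy)
    exact append x (hl x List.mem_cons_self) _ (join_mem_kstar hl') (ih hl' _)

/-- The end of x falls inside, or at the end of, some factor `z ++ a` from L; a non-empty x
guarantees that such a factor exists. -/
theorem exists_split_of_append_mem_kstar {L : Language α} {x w : List α} (h : x ++ w ∈ L∗)
    (hx : x ≠ []) :
    ∃ y z a b, y ++ z = x ∧ a ++ b = w ∧ y ∈ L∗ ∧ z ++ a ∈ L ∧ b ∈ L∗ := by
  generalize hv : x ++ w = v at h
  induction h using kstar_induction generalizing x with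
  | nil => simp_all
  | append s hs t ht ih =>
    rcases List.append_eq_append_iff.1 hv with ⟨z, rfl, rfl⟩ | ⟨z, rfl, rfl⟩
    · exact ⟨[], x, z, t, rfl, rfl, nil_mem_kstar _, hs, ht⟩
    · rcases eq_or_ne z [] with rfl | hz
      · exact ⟨[], s, [], w, by simp, rfl, nil_mem_kstar _, by simpa using hs, ht⟩
      · obtain ⟨y, z', a, b, rfl, hw, hy, hza, hb⟩ := ih hz rfl
        exact ⟨s ++ y, z', a, b, by simp, hw, append_mem_kstar (mem_kstar_of_mem hs) hy, hza, hb⟩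

theorem IsRegular.kstar {L : Language α} (hL : L.IsRegular) : L∗.IsRegular := by
  apply IsRegular.of_finite_range_leftQuotient
  -- For x non-empty the quotient is `(⋃ z\L) L∗` over splittings x = yz with y in `L∗`. The empty x
  -- is kept apart, because this formula would then give `L L∗`, which may lack the empty word.
  refine ((hL.finite_range_leftQuotient.powerset.image fun S : Set (Language α) =>
    sSup S * L∗).insert L∗).subset ?_
  rintro _ ⟨x, rfl⟩
  rcases eq_or_ne x [] with rfl | hx
  · exact Or.inl rfl
  refine Or.inr ⟨{B | ∃ y z, y ++ z = x ∧ y ∈ L∗ ∧ L.leftQuotient z = B}, ?_, ?_⟩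
  · rintro _ ⟨y, z, -, -, rfl⟩
    exact ⟨z, rfl⟩
  · ext w
    rw [mem_leftQuotient, mem_mul]
    simp only [mem_sSup]
    constructor
    · rintro ⟨a, ⟨_, ⟨y, z, rfl, hy, rfl⟩, ha⟩, b, hb, rfl⟩
      have := append_mem_kstar hy (append_mem_kstar (mem_kstar_of_mem ha) hb)
      simpa using this
    · intro h
      obtain ⟨y, z, a, b, hyz, rfl, hy, hza, hb⟩ := exists_split_of_append_mem_kstar h hx
      exact ⟨a, ⟨_, ⟨y, z, hyz, hy, rfl⟩, hza⟩, b, hb, rfl⟩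

theorem mem_map {f : α → β} {L : Language α} {x : List β} :
    x ∈ map f L ↔ ∃ w ∈ L, w.map f = x := Iff.rfl

theorem IsRegular.map (f : α → β) {L : Language α} (hL : L.IsRegular) :
    (Language.map f L).IsRegular := by
  apply IsRegular.of_finite_range_leftQuotient
  refine (hL.finite_range_leftQuotient.powerset.image fun S : Set (Language α) =>
    Language.map f (sSup S)).subset ?_
  rintro _ ⟨x, rfl⟩
  refine ⟨{B | ∃ y, y.map f = x ∧ L.leftQuotient y = B}, ?_, ?_⟩
  · rintro _ ⟨y, -, rfl⟩
    exact ⟨y, rfl⟩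
  · ext w
    rw [mem_leftQuotient, mem_map, mem_map]
    simp only [mem_sSup]
    constructor
    · rintro ⟨a, ⟨_, ⟨y, rfl, rfl⟩, ha⟩, rfl⟩
      exact ⟨y ++ a, ha, by simp⟩
    · rintro ⟨v, hv, h⟩
      obtain ⟨y, a, rfl, rfl, rfl⟩ := List.map_eq_append_iff.1 h
      exact ⟨a, ⟨_, ⟨y, rfl, rfl⟩, hv⟩, rfl⟩

theorem isRegular_singleton (w : List α) : IsRegular ({w} : Language α) := by
  apply IsRegular.of_finite_range_leftQuotient
  refine (((List.finite_toSet w.tails).image fun z => ({z} : Language α)).insert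
    0).subset ?_
  rintro _ ⟨x, rfl⟩
  by_cases h : x <+: w
  · obtain ⟨z, rfl⟩ := h
    refine Or.inr ⟨z, by simp, ?_⟩
    ext v
    exact (List.append_cancel_left_eq x v z).symm.to_iff
  · refine Or.inl ?_
    ext v
    exact iff_of_false (fun hv => h ⟨v, hv⟩) (notMem_zero v)

theorem IsRegular.sub_one {L : Language α} (hL : L.IsRegular) : (L - 1).IsRegular :=
  hL.inf (isRegular_singleton []).compl

/-! ### Intersection of a context-free language with a regular one -/

variable {T N σ : Type*}

/-- The ways to annotate a sentential form so that it describes a run of `A` from `p` to `q`: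
each nonterminal is given the states before and after the word it will produce. -/
def annotations (A : DFA T σ) :
    List (Symbol T N) → σ → σ → Set (List (Symbol T (Option (σ × N × σ))))
  | [], p, q => {b | b = [] ∧ p = q}
  | .terminal t :: l, p, q => {b | ∃ b' ∈ annotations A l (A.step p t) q, b = .terminal t :: b'}
  | .nonterminal X :: l, p, q =>
    {b | ∃ r, ∃ b' ∈ annotations A l r q, b = .nonterminal (some (p, X, r)) :: b'}

theorem finite_annotations [Finite σ] (A : DFA T σ) (l : List (Symbol T N)) (p q : σ) :
    (annotations A l p q).Finite := by
  induction l generalizing p with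
  | nil => exact (Set.finite_singleton []).subset fun b hb => hb.1
  | cons s l ih =>
    cases s with
    | terminal t =>
      refine ((ih (A.step p t)).image (Symbol.terminal t :: ·)).subset ?_
      rintro _ ⟨b, hb, rfl⟩
      exact ⟨b, hb, rfl⟩
    | nonterminal X =>
      refine (Set.finite_iUnion fun r =>
        (ih r).image (Symbol.nonterminal (some (p, X, r)) :: ·)).subset ?_
      rintro _ ⟨r, b, hb, rfl⟩
      exact Set.mem_iUnion.2 ⟨r, b, hb, rfl⟩

theorem mem_annotations_append {A : DFA T σ} {l₁ l₂ : List (Symbol T N)} {p q : σ}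
    {b : List (Symbol T (Option (σ × N × σ)))} :
    b ∈ annotations A (l₁ ++ l₂) p q ↔
      ∃ r, ∃ b₁ ∈ annotations A l₁ p r, ∃ b₂ ∈ annotations A l₂ r q, b = b₁ ++ b₂ := by
  induction l₁ generalizing p b with
  | nil =>
    constructor
    · exact fun h => ⟨p, [], ⟨rfl, rfl⟩, b, h, rfl⟩
    · rintro ⟨r, _, ⟨rfl, rfl⟩, b₂, h, rfl⟩
      exact h
  | cons s l ih =>
    cases s with
    | terminal t =>
      constructor
      · rintro ⟨b', hb', rfl⟩
        obtain ⟨r, b₁, h₁, b₂, h₂, rfl⟩ := ih.1 hb'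
        exact ⟨r, _, ⟨b₁, h₁, rfl⟩, b₂, h₂, rfl⟩
      · rintro ⟨r, _, ⟨b₁, h₁, rfl⟩, b₂, h₂, rfl⟩
        exact ⟨_, ih.2 ⟨r, b₁, h₁, b₂, h₂, rfl⟩, rfl⟩
    | nonterminal X =>
      constructor
      · rintro ⟨r', b', hb', rfl⟩
        obtain ⟨r, b₁, h₁, b₂, h₂, rfl⟩ := ih.1 hb'
        exact ⟨r, _, ⟨r', b₁, h₁, rfl⟩, b₂, h₂, rfl⟩
      · rintro ⟨r, _, ⟨r', b₁, h₁, rfl⟩, b₂, h₂, rfl⟩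
        exact ⟨r', _, ih.2 ⟨r, b₁, h₁, b₂, h₂, rfl⟩, rfl⟩

theorem mem_annotations_terminals {A : DFA T σ} {w : List T} {p q : σ}
    {b : List (Symbol T (Option (σ × N × σ)))} :
    b ∈ annotations (N := N) A (w.map .terminal) p q ↔
      b = w.map .terminal ∧ A.evalFrom p w = q := by
  induction w generalizing p b with
  | nil => exact Iff.rfl
  | cons t w ih =>
    constructor
    · rintro ⟨b', hb', rfl⟩
      obtain ⟨rfl, h⟩ := ih.1 hb'
      exact ⟨rfl, h⟩
    · rintro ⟨rfl, h⟩
      exact ⟨_, ih.2 ⟨rfl, h⟩, rfl⟩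

theorem eq_terminals_of_mem_annotations {A : DFA T σ} {w : List T} {p q : σ}
    {l : List (Symbol T N)} (h : w.map .terminal ∈ annotations A l p q) :
    l = w.map .terminal := by
  induction l generalizing w p with
  | nil => rw [List.map_eq_nil_iff.1 h.1, List.map_nil]
  | cons s l ih =>
    cases s with
    | terminal t =>
      obtain ⟨b, hb, h⟩ := h
      obtain ⟨t', w', rfl, ht, rfl⟩ := List.map_eq_cons_iff.1 h
      cases ht
      rw [ih hb, List.map_cons]
    | nonterminal X =>
      obtain ⟨r, b, hb, h⟩ := h
      obtain ⟨t', w', rfl, ht, rfl⟩ := List.map_eq_cons_iff.1 h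
      cases ht

theorem exists_of_append_cons_mem_annotations {A : DFA T σ} {l : List (Symbol T N)} {p q : σ}
    {b₁ b₂ : List (Symbol T (Option (σ × N × σ)))} {Y : Option (σ × N × σ)}
    (h : b₁ ++ .nonterminal Y :: b₂ ∈ annotations A l p q) :
    ∃ l₁ l₂ r X r', Y = some (r, X, r') ∧ l = l₁ ++ .nonterminal X :: l₂ ∧
      b₁ ∈ annotations A l₁ p r ∧ b₂ ∈ annotations A l₂ r' q := by
  induction l generalizing b₁ p with
  | nil => simp [annotations] at h
  | cons s l ih =>
    cases s with
    | terminal t =>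
      obtain ⟨b, hb, h⟩ := h
      cases b₁ with
      | nil => simp at h
      | cons c b₁ =>
        obtain ⟨rfl, rfl⟩ := List.cons.inj h
        obtain ⟨l₁, l₂, r, X, r', hY, rfl, h₁, h₂⟩ := ih hb
        exact ⟨_ :: l₁, l₂, r, X, r', hY, rfl, ⟨b₁, h₁, rfl⟩, h₂⟩
    | nonterminal Z =>
      obtain ⟨s, b, hb, h⟩ := h
      cases b₁ with
      | nil =>
        obtain ⟨hY, rfl⟩ := List.cons.inj h
        cases hY
        exact ⟨[], l, p, Z, s, rfl, rfl, ⟨rfl, rfl⟩, hb⟩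
      | cons c b₁ =>
        obtain ⟨rfl, rfl⟩ := List.cons.inj h
        obtain ⟨l₁, l₂, r, X, r', hY, rfl, h₁, h₂⟩ := ih hb
        exact ⟨_ :: l₁, l₂, r, X, r', hY, rfl, ⟨s, b₁, h₁, rfl⟩, h₂⟩

/-- The rules of the grammar for the intersection of `g.language` with `A.accepts`. -/
def interRules {T : Type*} {σ : Type} (g : ContextFreeGrammar T) (A : DFA T σ) :
    Set (ContextFreeRule T (Option (σ × g.NT × σ))) :=
  {r' | ∃ q ∈ A.accept, r' = ⟨none, [.nonterminal (some (A.start, g.initial, q))]⟩} ∪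
    {r' | ∃ r ∈ g.rules, ∃ p q, ∃ b ∈ annotations A r.output p q,
      r' = ⟨some (p, r.input, q), b⟩}

theorem finite_interRules {T : Type*} {σ : Type} [Finite σ] (g : ContextFreeGrammar T)
    (A : DFA T σ) : (interRules g A).Finite := by
  refine .union ?_ ?_
  · refine ((Set.toFinite A.accept).image fun q =>
      (⟨none, [.nonterminal (some (A.start, g.initial, q))]⟩ :
        ContextFreeRule T (Option (σ × g.NT × σ)))).subset ?_
    rintro _ ⟨q, hq, rfl⟩
    exact ⟨q, hq, rfl⟩
  · refine (g.rules.finite_toSet.biUnion fun r _ => Set.finite_iUnion fun p =>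
      Set.finite_iUnion fun q => (finite_annotations A r.output p q).image fun b =>
        (⟨some (p, r.input, q), b⟩ : ContextFreeRule T (Option (σ × g.NT × σ)))).subset ?_
    rintro _ ⟨r, hr, p, q, b, hb, rfl⟩
    simp only [Set.mem_iUnion]
    exact ⟨r, hr, p, q, b, hb, rfl⟩

/-- The grammar for the intersection of `g.language` with `A.accepts`. -/
noncomputable def interGrammar {T : Type*} {σ : Type} [Finite σ] (g : ContextFreeGrammar T)
    (A : DFA T σ) : ContextFreeGrammar T where
  NT := Option (σ × g.NT × σ)
  initial := none
  rules := (finite_interRules g A).toFinset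

section inter

variable {T : Type*} {σ : Type} [Finite σ] {g : ContextFreeGrammar T} {A : DFA T σ}

/-- Forgetting the states turns each step into a step of `g`, and a rule's annotated output fits
exactly between the two states of the nonterminal it replaces. -/
theorem derives_of_interGrammar_derives {b b' : List (Symbol T (Option (σ × g.NT × σ)))}
    (h : (interGrammar g A).Derives b b') {l : List (Symbol T g.NT)} {p q : σ}
    (hb : b ∈ annotations A l p q) : ∃ l', g.Derives l l' ∧ b' ∈ annotations A l' p q := by
  induction h with
  | refl => exact ⟨l, .refl _, hb⟩
  | tail _ hstep ih =>
    obtain ⟨l', hl', hb'⟩ := ih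
    obtain ⟨r', hr', hrew⟩ := hstep
    obtain ⟨b₁, b₂, rfl, rfl⟩ := hrew.exists_parts
    rw [List.append_assoc] at hb'
    obtain ⟨l₁, l₂, s, X, s', hY, rfl, h₁, h₂⟩ := exists_of_append_cons_mem_annotations hb'
    rcases (finite_interRules g A).mem_toFinset.1 hr' with
      ⟨_, _, rfl⟩ | ⟨r, hr, p', q', c, hc, rfl⟩
    -- The start symbol `none` never occurs in an annotated form, so start rules cannot apply.
    · cases hY
    · cases hY
      refine ⟨l₁ ++ r.output ++ l₂, hl'.tail ⟨r, hr, ?_⟩, ?_⟩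
      · simpa using r.rewrites_of_exists_parts l₁ l₂
      · exact mem_annotations_append.2
          ⟨_, _, mem_annotations_append.2 ⟨_, _, h₁, _, hc, rfl⟩, _, h₂, rfl⟩

/-- The states around a nonterminal depend on the word it will produce, so annotations are pulled
back from the end of the derivation to its beginning. -/
theorem exists_interGrammar_derives {l l' : List (Symbol T g.NT)} (h : g.Derives l l') {p q : σ}
    {b' : List (Symbol T (Option (σ × g.NT × σ)))} (hb' : b' ∈ annotations A l' p q) :
    ∃ b ∈ annotations A l p q, (interGrammar g A).Derives b b' := by
  induction h using Relation.ReflTransGen.head_induction_on with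
  | refl => exact ⟨b', hb', .refl _⟩
  | head hstep _ ih =>
    obtain ⟨b, hb, hbb'⟩ := ih
    obtain ⟨r, hr, hrew⟩ := hstep
    obtain ⟨l₁, l₂, rfl, rfl⟩ := hrew.exists_parts
    obtain ⟨s', _, hx, b₂, h₂, rfl⟩ := mem_annotations_append.1 hb
    obtain ⟨s, b₁, h₁, c, hc, rfl⟩ := mem_annotations_append.1 hx
    refine ⟨b₁ ++ [.nonterminal (some (s, r.input, s'))] ++ b₂, ?_, .head ?_ hbb'⟩
    · exact mem_annotations_append.2 ⟨_, _, mem_annotations_append.2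
        ⟨_, _, h₁, _, ⟨s', [], ⟨rfl, rfl⟩, rfl⟩, rfl⟩, _, h₂, rfl⟩
    · exact ⟨⟨some (s, r.input, s'), c⟩,
        (finite_interRules g A).mem_toFinset.2 (Or.inr ⟨r, hr, s, s', c, hc, rfl⟩),
        ContextFreeRule.rewrites_of_exists_parts _ b₁ b₂⟩

theorem interGrammar_language (g : ContextFreeGrammar T) (A : DFA T σ) :
    (interGrammar g A).language = g.language ⊓ A.accepts := by
  ext w
  rw [mem_inf]
  constructor
  · intro h
    rcases ContextFreeGrammar.Derives.eq_or_head h with h | ⟨b, ⟨r', hr', hrew⟩, h⟩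
    · cases w <;> simp at h
    obtain ⟨b₁, b₂, hb, rfl⟩ := hrew.exists_parts
    obtain ⟨rfl, hb, rfl⟩ : b₁ = [] ∧ r'.input = none ∧ b₂ = [] := by
      cases b₁ with
      | nil =>
        obtain ⟨h₁, h₂⟩ := List.cons.inj hb
        exact ⟨rfl, (Symbol.nonterminal.inj h₁).symm, h₂.symm⟩
      | cons c b₁ => simp at hb
    rcases (finite_interRules g A).mem_toFinset.1 hr' with ⟨q, hq, rfl⟩ | ⟨r, _, p, q, c, _, rfl⟩
    · obtain ⟨l, hl, hw⟩ := derives_of_interGrammar_derives h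
        (l := [.nonterminal g.initial]) (p := A.start) (q := q) ⟨q, [], ⟨rfl, rfl⟩, rfl⟩
      obtain rfl := eq_terminals_of_mem_annotations hw
      refine ⟨hl, ?_⟩
      rw [DFA.mem_accepts, DFA.eval, (mem_annotations_terminals.1 hw).2]
      exact hq
    · cases hb
  · rintro ⟨h, hw⟩
    obtain ⟨b, ⟨_, _, ⟨rfl, rfl⟩, rfl⟩, hd⟩ := exists_interGrammar_derives h
      (A := A) (mem_annotations_terminals.2 ⟨rfl, rfl⟩)
    refine .head ⟨⟨none, _⟩,
      (finite_interRules g A).mem_toFinset.2 (Or.inl ⟨_, hw, rfl⟩), ?_⟩ hd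
    exact ContextFreeRule.Rewrites.input_output

end inter

theorem IsContextFree.inf_isRegular {T : Type*} {L K : Language T} (hL : L.IsContextFree)
    (hK : K.IsRegular) : (L ⊓ K).IsContextFree := by
  obtain ⟨g, rfl⟩ := hL
  obtain ⟨σ, _, A, rfl⟩ := hK
  exact ⟨interGrammar g A, interGrammar_language g A⟩

/-! ### Letter-to-letter and erasing images of context-free languages -/

variable {T' : Type*}

/-- The action on symbols of a partial map of terminals. -/
def symbolMap (f : T → Option T') : Symbol T N → Option (Symbol T' N)
  | .terminal t => (f t).map .terminal
  | .nonterminal X => some (.nonterminal X)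

theorem filterMap_symbolMap_terminal (f : T → Option T') (w : List T) :
    (w.map Symbol.terminal).filterMap (symbolMap (N := N) f) =
      (w.filterMap f).map Symbol.terminal := by
  rw [List.filterMap_map, List.map_filterMap]
  rfl

theorem eq_terminals_of_filterMap_symbolMap {f : T → Option T'} {l : List (Symbol T N)}
    {w' : List T'} (h : l.filterMap (symbolMap f) = w'.map Symbol.terminal) :
    ∃ w : List T, l = w.map Symbol.terminal := by
  induction l generalizing w' with
  | nil => exact ⟨[], rfl⟩
  | cons s l ih =>
    cases s with
    | terminal t =>
      rw [List.filterMap_cons] at h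
      cases hf : f t with
      | none =>
        obtain ⟨w, rfl⟩ := ih (w' := w') (by simpa [symbolMap, hf] using h)
        exact ⟨t :: w, rfl⟩
      | some t' =>
        simp only [symbolMap, hf, Option.map_some] at h
        obtain ⟨_, w'', rfl, _, h⟩ := List.map_eq_cons_iff.1 h.symm
        obtain ⟨w, rfl⟩ := ih h.symm
        exact ⟨t :: w, rfl⟩
    | nonterminal X =>
      cases w' <;> simp [symbolMap] at h

open Classical in
/-- The grammar that generates the images under `f` of the words of `g.language`. -/
noncomputable def filterMapGrammar {T T' : Type*} (f : T → Option T')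
    (g : ContextFreeGrammar T) : ContextFreeGrammar T' where
  NT := g.NT
  initial := g.initial
  rules := g.rules.image fun r => ⟨r.input, r.output.filterMap (symbolMap f)⟩

section filterMap

variable {T T' : Type*} {f : T → Option T'} {g : ContextFreeGrammar T}

theorem filterMapGrammar_derives {l l' : List (Symbol T g.NT)} (h : g.Derives l l') :
    (filterMapGrammar f g).Derives (l.filterMap (symbolMap f)) (l'.filterMap (symbolMap f)) := by
  classical
  induction h with
  | refl => exact .refl _
  | tail _ hstep ih =>
    obtain ⟨r, hr, hrew⟩ := hstep
    obtain ⟨l₁, l₂, rfl, rfl⟩ := hrew.exists_parts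
    refine ih.tail ⟨_, Finset.mem_image_of_mem _ hr, ?_⟩
    have : (⟨r.input, r.output.filterMap (symbolMap f)⟩ : ContextFreeRule T' g.NT).Rewrites
        ((l₁ ++ [Symbol.nonterminal r.input] ++ l₂).filterMap (symbolMap f))
        ((l₁ ++ r.output ++ l₂).filterMap (symbolMap f)) := by
      simp only [List.filterMap_append]
      exact ContextFreeRule.rewrites_of_exists_parts _ _ _
    exact this

/-- Only terminals are erased, so every nonterminal of the image comes from an occurrence upstairs,
where the original rule applies. -/
theorem exists_derives_of_filterMapGrammar_derives {l : List (Symbol T g.NT)}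
    {b : List (Symbol T' g.NT)}
    (h : (filterMapGrammar f g).Derives (l.filterMap (symbolMap f)) b) :
    ∃ l', g.Derives l l' ∧ l'.filterMap (symbolMap f) = b := by
  classical
  induction h with
  | refl => exact ⟨l, .refl _, rfl⟩
  | tail _ hstep ih =>
    obtain ⟨l', hl', rfl⟩ := ih
    obtain ⟨r', hr', hrew⟩ := hstep
    obtain ⟨r, hr, rfl⟩ := Finset.mem_image.1 hr'
    obtain ⟨b₁, b₂, h, rfl⟩ := hrew.exists_parts
    rw [List.append_assoc] at h
    obtain ⟨l₁, l₂, rfl, rfl, hl₂⟩ := List.filterMap_eq_append_iff.1 h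
    -- `l₃` is the run of erased terminals just before the nonterminal to be rewritten.
    obtain ⟨l₃, s, l₄, rfl, h₃, hs, rfl⟩ := List.filterMap_eq_cons_iff.1 hl₂
    obtain rfl : s = .nonterminal r.input := by
      cases s with
      | terminal t =>
        obtain ⟨_, _, h⟩ := Option.map_eq_some_iff.1 hs
        cases h
      | nonterminal X => cases hs; rfl
    refine ⟨l₁ ++ l₃ ++ r.output ++ l₄, hl'.tail ⟨r, hr, ?_⟩, ?_⟩
    · simpa using r.rewrites_of_exists_parts (l₁ ++ l₃) l₄
    · simp only [List.filterMap_append, List.filterMap_eq_nil_iff.2 h₃, List.append_nil]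
      rfl

theorem mem_filterMapGrammar_language {w' : List T'} :
    w' ∈ (filterMapGrammar f g).language ↔ ∃ w ∈ g.language, w.filterMap f = w' := by
  constructor
  · intro h
    obtain ⟨l, hl, hw⟩ := exists_derives_of_filterMapGrammar_derives (f := f)
      (l := [.nonterminal g.initial]) h
    obtain ⟨w, rfl⟩ := eq_terminals_of_filterMap_symbolMap hw
    rw [filterMap_symbolMap_terminal] at hw
    exact ⟨w, hl, List.map_injective_iff.2 (fun _ _ => Symbol.terminal.inj) hw⟩
  · rintro ⟨w, hw, rfl⟩
    exact Eq.subst (motive := (filterMapGrammar f g).Derives [.nonterminal g.initial])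
      (filterMap_symbolMap_terminal f w) (filterMapGrammar_derives (f := f) hw)

end filterMap

/-- The image of a language under a partial map of letters, which erases the letters where it is
undefined. -/
def filterMap (f : T → Option T') (L : Language T) : Language T' :=
  {w' | ∃ w ∈ L, w.filterMap f = w'}

theorem IsContextFree.filterMap {L : Language T} (hL : L.IsContextFree) (f : T → Option T') :
    (Language.filterMap f L).IsContextFree := by
  obtain ⟨g, rfl⟩ := hL
  exact ⟨filterMapGrammar f g, Set.ext fun _ => mem_filterMapGrammar_language⟩

end Language

namespace WordHyp

open Language

/-! ### Values of words and the failure of 1-uniqueness -/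

section eval

variable {A M : Type*} [Monoid M] (π : FreeMonoid A →* M)

theorem eval_nil : eval π [] = 1 := π.map_one

theorem eval_append (u v : List A) : eval π (u ++ v) = eval π u * eval π v :=
  π.map_mul (FreeMonoid.ofList u) (FreeMonoid.ofList v)

variable {π}

/-- 1-uniqueness could also fail because the empty word is not in R; then the representative of 1
supplied by surjectivity is non-empty. -/
theorem exists_ne_nil_eval_eq_one {R : Language A} (hR : IsRegularCombing π R)
    (hu : ¬ OneUnique π R) : ∃ e ∈ R, e ≠ [] ∧ eval π e = 1 := by
  by_contra! h
  refine hu (Set.ext fun w => ⟨fun hw => ?_, ?_⟩)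
  · by_contra hne
    exact h w hw.1 hne hw.2
  · rintro rfl
    obtain ⟨w, hw, hw1⟩ := hR.surj 1
    obtain rfl : w = [] := by
      by_contra hne
      exact h w hw hne hw1
    exact ⟨hw, hw1⟩

end eval

/-! ### Multiplication tables under restriction and change of letters -/

section multTable

variable {A B M N : Type*}

/-- The words `u #₁ v #₂ wʳᵉᵛ` with `u`, `v`, `w` in `K`. -/
def markedTriples (K : Language A) : Language (Marked A) :=
  map Marked.letter K * {[Marked.hash₁]} * map Marked.letter K *
    {[Marked.hash₂]} * map Marked.letter K.reverse

theorem isRegular_markedTriples {K : Language A} (hK : K.IsRegular) :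
    (markedTriples K).IsRegular :=
  ((((hK.map _).mul (isRegular_singleton _)).mul (hK.map _)).mul
    (isRegular_singleton _)).mul (hK.reverse.map _)

theorem mem_markedTriples {K : Language A} {x : List (Marked A)} :
    x ∈ markedTriples K ↔ ∃ u ∈ K, ∃ v ∈ K, ∃ w ∈ K,
      x = u.map Marked.letter ++ [Marked.hash₁] ++ v.map Marked.letter ++ [Marked.hash₂] ++
        w.reverse.map Marked.letter := by
  constructor
  · rintro ⟨_, ⟨_, ⟨_, ⟨_, ⟨u, hu, rfl⟩, _, rfl, rfl⟩, _, ⟨v, hv, rfl⟩, rfl⟩, _, rfl, rfl⟩, _,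
      ⟨w, hw, rfl⟩, rfl⟩
    exact ⟨u, hu, v, hv, w.reverse, hw, by simp⟩
  · rintro ⟨u, hu, v, hv, w, hw, rfl⟩
    exact ⟨_, ⟨_, ⟨_, ⟨_, ⟨u, hu, rfl⟩, _, rfl, rfl⟩, _, ⟨v, hv, rfl⟩, rfl⟩, _, rfl, rfl⟩, _,
      ⟨w.reverse, reverse_mem_reverse.2 hw, rfl⟩, rfl⟩

theorem map_letter_append_cons_inj {u u' : List A} {h : Marked A} {t t' : List (Marked A)}
    (hh : ∀ a, h ≠ Marked.letter a)
    (e : u.map Marked.letter ++ h :: t = u'.map Marked.letter ++ h :: t') :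
    u = u' ∧ t = t' := by
  induction u generalizing u' with
  | nil =>
    cases u' with
    | nil => exact ⟨rfl, (List.cons.inj e).2⟩
    | cons a u' => exact absurd (List.cons.inj e).1 (hh a)
  | cons a u ih =>
    cases u' with
    | nil => exact absurd (List.cons.inj e).1.symm (hh a)
    | cons a' u' =>
      obtain ⟨h₁, h₂⟩ := List.cons.inj e
      obtain ⟨rfl, rfl⟩ := ih h₂
      exact ⟨by rw [Marked.letter.inj h₁], rfl⟩

/-- The separators are not letters, so a marked word determines its triple; a membership in the
table of R and one in the triples over K thus concern the same u, v, w. -/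
theorem marked_inj {u v w u' v' w' : List A}
    (e : u.map Marked.letter ++ [Marked.hash₁] ++ v.map Marked.letter ++ [Marked.hash₂] ++
        w.reverse.map Marked.letter =
      u'.map Marked.letter ++ [Marked.hash₁] ++ v'.map Marked.letter ++ [Marked.hash₂] ++
        w'.reverse.map Marked.letter) : u = u' ∧ v = v' ∧ w = w' := by
  simp only [List.append_assoc, List.cons_append, List.nil_append] at e
  obtain ⟨rfl, e₁⟩ := map_letter_append_cons_inj (by simp) e
  obtain ⟨rfl, e₂⟩ := map_letter_append_cons_inj (by simp) e₁
  exact ⟨rfl, rfl, List.reverse_injective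
    (List.map_injective_iff.2 (fun _ _ => Marked.letter.inj) e₂)⟩

variable [Monoid M] [Monoid N]

theorem multTable_eq_inf {π : FreeMonoid A →* M} {K R : Language A} (hKR : K ≤ R) :
    multTable π K = multTable π R ⊓ markedTriples K := by
  ext x
  rw [mem_inf, mem_markedTriples]
  constructor
  · rintro ⟨u, hu, v, hv, w, hw, h, rfl⟩
    exact ⟨⟨u, hKR hu, v, hKR hv, w, hKR hw, h, rfl⟩, u, hu, v, hv, w, hw, rfl⟩
  · rintro ⟨⟨u, -, v, -, w, -, h, rfl⟩, u', hu, v', hv, w', hw, e⟩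
    obtain ⟨rfl, rfl, rfl⟩ := marked_inj e
    exact ⟨u, hu, v, hv, w, hw, h, rfl⟩

/-- The extension of a partial map of letters that fixes the two new symbols. -/
def markedMap (f : B → Option A) : Marked B → Option (Marked A)
  | .letter b => (f b).map .letter
  | .hash₁ => some .hash₁
  | .hash₂ => some .hash₂

theorem filterMap_markedMap (f : B → Option A) (u v w : List B) :
    (u.map Marked.letter ++ [Marked.hash₁] ++ v.map Marked.letter ++ [Marked.hash₂] ++
        w.reverse.map Marked.letter).filterMap (markedMap f) =
      (u.filterMap f).map Marked.letter ++ [Marked.hash₁] ++ (v.filterMap f).map Marked.letter ++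
        [Marked.hash₂] ++ (w.filterMap f).reverse.map Marked.letter := by
  have h (l : List B) : (l.map Marked.letter).filterMap (markedMap f) =
      (l.filterMap f).map Marked.letter := by
    rw [List.filterMap_map, List.map_filterMap]
    rfl
  simp only [List.filterMap_append, h, List.filterMap_reverse]
  rfl

theorem IsWordHyperbolicWrt.mono {π : FreeMonoid A →* M} {R K : Language A}
    (hR : IsWordHyperbolicWrt π R) (hKR : K ≤ R) (hK : IsRegularCombing π K) :
    IsWordHyperbolicWrt π K := by
  refine ⟨hK, ?_⟩
  rw [multTable_eq_inf hKR]
  exact hR.contextFree.inf_isRegular (isRegular_markedTriples hK.regular)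

/-- Word-hyperbolicity passes to the image `S` of a regular sublanguage `K` of `R` under a map
that relabels and erases letters, when it is compatible with an embedding of monoids. -/
theorem IsWordHyperbolicWrt.of_filterMap {ρ : FreeMonoid B →* N} {R : Language B}
    (hR : IsWordHyperbolicWrt ρ R) {π : FreeMonoid A →* M} {S : Language A}
    (hS : IsRegularCombing π S) {K : Language B} (hK : K.IsRegular) (hKR : K ≤ R)
    {ι : M →* N} (hι : Function.Injective ι) (f : B → Option A)
    (hf : ∀ k ∈ K, k.filterMap f ∈ S) (heval : ∀ k ∈ K, eval ρ k = ι (eval π (k.filterMap f)))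
    (hsurj : ∀ u ∈ S, ∃ k ∈ K, k.filterMap f = u) : IsWordHyperbolicWrt π S := by
  refine ⟨hS, ?_⟩
  have hcf : (multTable ρ K).IsContextFree := by
    rw [multTable_eq_inf hKR]
    exact hR.contextFree.inf_isRegular (isRegular_markedTriples hK)
  -- Surjectivity onto S lifts a triple to K; injectivity of `ι` brings an equation between values
  -- in N back to M.
  suffices multTable π S = Language.filterMap (markedMap f) (multTable ρ K) from
    this ▸ hcf.filterMap (markedMap f)
  ext x
  constructor
  · rintro ⟨u, hu, v, hv, w, hw, h, rfl⟩
    obtain ⟨u, ku, rfl⟩ := hsurj u hu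
    obtain ⟨v, kv, rfl⟩ := hsurj v hv
    obtain ⟨w, kw, rfl⟩ := hsurj w hw
    refine ⟨_, ⟨u, ku, v, kv, w, kw, ?_, rfl⟩, filterMap_markedMap f u v w⟩
    rw [heval u ku, heval v kv, heval w kw, ← map_mul, h]
  · rintro ⟨_, ⟨u, hu, v, hv, w, hw, h, rfl⟩, rfl⟩
    refine ⟨_, hf u hu, _, hf v hv, _, hf w hw, hι ?_, filterMap_markedMap f u v w⟩
    rw [map_mul, ← heval u hu, ← heval v hv, ← heval w hw, h]

theorem IsRegularCombing.kstar {π : FreeMonoid A →* M} {R : Language A}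
    (hR : IsRegularCombing π R) : IsRegularCombing π R∗ where
  regular := hR.regular.kstar
  surj m := by
    obtain ⟨w, hw, h⟩ := hR.surj m
    exact ⟨w, mem_kstar_of_mem hw, h⟩

/-- The generating set must live in `Type`, so A is relabelled as `Fin n`. -/
theorem IsWordHyperbolicWrt.isStarWordHyperbolic [Finite A] {π : FreeMonoid A →* M}
    {R : Language A} (hR : IsWordHyperbolicWrt π R) (hstar : R∗ = R) :
    IsStarWordHyperbolic M := by
  obtain ⟨n, ⟨e⟩⟩ := Finite.exists_equiv_fin A
  have heval (w : List A) : eval (π.comp (FreeMonoid.map e.symm)) (w.map e) = eval π w := by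
    change π (FreeMonoid.map e.symm (FreeMonoid.map e (FreeMonoid.ofList w))) = _
    rw [FreeMonoid.map_map]
    simp [eval]
  have hmap (w : List A) : w.filterMap (fun a => some (e a)) = w.map e :=
    congrFun (List.filterMap_eq_map (f := e)) w
  refine ⟨Fin n, inferInstance, π.comp (FreeMonoid.map e.symm), map e R, ?_, ?_⟩
  · refine hR.of_filterMap (ι := MonoidHom.id M) ⟨hR.combing.regular.map e, fun m => ?_⟩
      hR.combing.regular le_rfl Function.injective_id (fun a => some (e a)) ?_ ?_ ?_
    · obtain ⟨w, hw, h⟩ := hR.combing.surj m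
      exact ⟨w.map e, ⟨w, hw, rfl⟩, (heval w).trans h⟩
    · exact fun k hk => ⟨k, hk, (hmap k).symm⟩
    · exact fun k _ => by rw [hmap, heval, MonoidHom.id_apply]
    · rintro _ ⟨k, hk, rfl⟩
      exact ⟨k, hk, hmap k⟩
  · rw [← map_kstar, hstar]

end multTable

/-! ### Block words in the free product -/

section coprod

variable {A₁ A₂ M₁ M₂ : Type*} [Monoid M₁] [Monoid M₂]
  {π₁ : FreeMonoid A₁ →* M₁} {π₂ : FreeMonoid A₂ →* M₂} {R₁ : Language A₁} {R₂ : Language A₂}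

theorem eval_freeProdHom_map_inl (u : List A₁) :
    eval (freeProdHom π₁ π₂) (u.map Sum.inl) = Monoid.Coprod.inl (eval π₁ u) := by
  induction u with
  | nil => simp [eval_nil]
  | cons a u ih =>
    rw [List.map_cons, ← List.singleton_append, eval_append, ih, ← List.singleton_append (l := u),
      eval_append, map_mul]
    rfl

theorem eval_freeProdHom_map_inr (v : List A₂) :
    eval (freeProdHom π₁ π₂) (v.map Sum.inr) = Monoid.Coprod.inr (eval π₂ v) := by
  induction v with
  | nil => simp [eval_nil]
  | cons a u ih =>
    rw [List.map_cons, ← List.singleton_append, eval_append, ih, ← List.singleton_append (l := u),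
      eval_append, map_mul]
    rfl

theorem filterMap_getLeft_append (u : List A₁) (v : List A₂) :
    (u.map Sum.inl ++ v.map Sum.inr).filterMap Sum.getLeft? = u := by
  simp [List.filterMap_append, List.filterMap_map, Function.comp_def]

theorem filterMap_getRight_append (u : List A₁) (v : List A₂) :
    (u.map Sum.inl ++ v.map Sum.inr).filterMap Sum.getRight? = v := by
  simp [List.filterMap_append, List.filterMap_map, Function.comp_def]

/-- The products of blocks `u v`, with `u` in `L₁` and `v` in `L₂`. -/
def blocks (L₁ : Language A₁) (L₂ : Language A₂) : Language (A₁ ⊕ A₂) :=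
  (map Sum.inl L₁ * map Sum.inr L₂)∗

theorem isRegular_blocks {L₁ : Language A₁} {L₂ : Language A₂} (h₁ : L₁.IsRegular)
    (h₂ : L₂.IsRegular) : (blocks L₁ L₂).IsRegular :=
  ((h₁.map _).mul (h₂.map _)).kstar

theorem block_mem_blocks {L₁ : Language A₁} {L₂ : Language A₂} {u : List A₁} {v : List A₂}
    (hu : u ∈ L₁) (hv : v ∈ L₂) : u.map Sum.inl ++ v.map Sum.inr ∈ blocks L₁ L₂ :=
  mem_kstar_of_mem ⟨_, ⟨u, hu, rfl⟩, _, ⟨v, hv, rfl⟩, rfl⟩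

theorem blocks_induction {L₁ : Language A₁} {L₂ : Language A₂}
    {p : ∀ w, w ∈ blocks L₁ L₂ → Prop} (nil : p [] (nil_mem_kstar _))
    (append : ∀ u (hu : u ∈ L₁) v (hv : v ∈ L₂) y (hy : y ∈ blocks L₁ L₂), p y hy →
      p (u.map Sum.inl ++ v.map Sum.inr ++ y) (append_mem_kstar (block_mem_blocks hu hv) hy))
    {w : List (A₁ ⊕ A₂)} (hw : w ∈ blocks L₁ L₂) : p w hw := by
  refine kstar_induction nil ?_ hw
  rintro _ ⟨_, ⟨u, hu, rfl⟩, _, ⟨v, hv, rfl⟩, rfl⟩ y hy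
  exact append u hu v hv y hy

theorem blocks_mono {L₁ L₁' : Language A₁} {L₂ L₂' : Language A₂} (h₁ : L₁ ≤ L₁')
    (h₂ : L₂ ≤ L₂') : blocks L₁ L₂ ≤ blocks L₁' L₂' := by
  intro w hw
  induction hw using blocks_induction with
  | nil => exact nil_mem_kstar _
  | append u hu v hv y _ ih => exact append_mem_kstar (block_mem_blocks (h₁ hu) (h₂ hv)) ih

theorem blocks_le_alt : blocks (R₁ - 1) (R₂ - 1) ≤ alt R₁ R₂ := by
  intro w hw
  -- The induction also records that the first factor, if any, is on the left, so that a block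
  -- ending on the right can be prepended.
  suffices ∃ xs : List (List A₁ ⊕ List A₂), (∀ x ∈ xs, IsFactor R₁ R₂ x) ∧
      xs.IsChain (fun x y => x.isLeft ≠ y.isLeft) ∧ w = (xs.map embedWord).flatten ∧
      ∀ x ∈ xs.head?, x.isLeft by
    obtain ⟨xs, h₁, h₂, h₃, -⟩ := this
    exact ⟨xs, h₁, h₂, h₃⟩
  induction hw using blocks_induction with
  | nil => exact ⟨[], by simp⟩
  | append u hu v hv y _ ih =>
    obtain ⟨xs, h₁, h₂, rfl, h₃⟩ := ih
    refine ⟨.inl u :: .inr v :: xs, ?_, ?_, by simp [embedWord], by simp⟩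
    · simp only [List.mem_cons, forall_eq_or_imp]
      exact ⟨hu, hv, h₁⟩
    · refine List.isChain_cons_cons.2 ⟨by simp, List.isChain_cons.2 ⟨fun x hx => ?_, h₂⟩⟩
      simp [h₃ x hx]

theorem isRegularCombing_blocks (h₁ : IsRegularCombing π₁ R₁) (h₂ : IsRegularCombing π₂ R₂)
    {e₁ : List A₁} (he₁ : e₁ ∈ R₁ - 1) (h1₁ : eval π₁ e₁ = 1)
    {e₂ : List A₂} (he₂ : e₂ ∈ R₂ - 1) (h1₂ : eval π₂ e₂ = 1) :
    IsRegularCombing (freeProdHom π₁ π₂) (blocks (R₁ - 1) (R₂ - 1)) where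
  regular := isRegular_blocks h₁.regular.sub_one h₂.regular.sub_one
  surj m := by
    induction m using Monoid.Coprod.induction_on with
    | inl m =>
      -- Dropping the empty word loses no element: `e₁` represents 1 in its place.
      obtain ⟨u, hu, rfl⟩ : ∃ u ∈ R₁ - 1, eval π₁ u = m := by
        obtain ⟨u, hu, rfl⟩ := h₁.surj m
        rcases eq_or_ne u [] with rfl | hne
        · exact ⟨e₁, he₁, h1₁.trans (eval_nil π₁).symm⟩
        · exact ⟨u, ⟨hu, hne⟩, rfl⟩
      refine ⟨_, block_mem_blocks hu he₂, ?_⟩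
      rw [eval_append, eval_freeProdHom_map_inl, eval_freeProdHom_map_inr, h1₂, map_one, mul_one]
    | inr m =>
      obtain ⟨v, hv, rfl⟩ : ∃ v ∈ R₂ - 1, eval π₂ v = m := by
        obtain ⟨v, hv, rfl⟩ := h₂.surj m
        rcases eq_or_ne v [] with rfl | hne
        · exact ⟨e₂, he₂, h1₂.trans (eval_nil π₂).symm⟩
        · exact ⟨v, ⟨hv, hne⟩, rfl⟩
      refine ⟨_, block_mem_blocks he₁ hv, ?_⟩
      rw [eval_append, eval_freeProdHom_map_inl, eval_freeProdHom_map_inr, h1₁, map_one, one_mul]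
    | mul a b iha ihb =>
      obtain ⟨x, hx, rfl⟩ := iha
      obtain ⟨y, hy, rfl⟩ := ihb
      exact ⟨x ++ y, append_mem_kstar hx hy, eval_append _ x y⟩

/-- The word `e₂` acts as a separator of value 1: it allows consecutive factors from `R₁` in a word
of R, and erasing it leaves their product. -/
theorem isWordHyperbolicWrt_kstar_left {R : Language (A₁ ⊕ A₂)}
    (h : IsWordHyperbolicWrt (freeProdHom π₁ π₂) R) (hR : blocks (R₁ - 1) (R₂ - 1) ≤ R)
    (h₁ : IsRegularCombing π₁ R₁) {e₂ : List A₂} (he₂ : e₂ ∈ R₂ - 1) (h1₂ : eval π₂ e₂ = 1) :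
    IsWordHyperbolicWrt π₁ R₁∗ := by
  have hle : blocks (R₁ - 1) {e₂} ≤ R :=
    (blocks_mono le_rfl (Set.singleton_subset_iff.2 he₂)).trans hR
  refine h.of_filterMap h₁.kstar
    (isRegular_blocks h₁.regular.sub_one (isRegular_singleton e₂)) hle
    (ι := Monoid.Coprod.inl) Monoid.Coprod.inl_injective Sum.getLeft? ?_ ?_ ?_
  · intro k hk
    induction hk using blocks_induction with
    | nil => exact nil_mem_kstar _
    | append u hu v hv y _ ih =>
      rw [List.filterMap_append, filterMap_getLeft_append]
      exact append_mem_kstar (mem_kstar_of_mem hu.1) ih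
  · intro k hk
    induction hk using blocks_induction with
    | nil => simp [eval_nil]
    | append u hu v hv y _ ih =>
      obtain rfl : v = e₂ := hv
      rw [List.filterMap_append, filterMap_getLeft_append, eval_append, eval_append, eval_append,
        eval_freeProdHom_map_inl, eval_freeProdHom_map_inr, h1₂, map_one, mul_one, ih, map_mul]
  · intro u hu
    induction hu using kstar_induction with
    | nil => exact ⟨[], nil_mem_kstar _, rfl⟩
    | append x hx y _ ih =>
      obtain ⟨k, hk, rfl⟩ := ih
      -- An empty factor contributes no block, since blocks need a non-empty left part.
      rcases eq_or_ne x [] with rfl | hne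
      · exact ⟨k, hk, rfl⟩
      · refine ⟨_, append_mem_kstar (block_mem_blocks ⟨hx, hne⟩ rfl) hk, ?_⟩
        rw [List.filterMap_append, filterMap_getLeft_append]

theorem isWordHyperbolicWrt_kstar_right {R : Language (A₁ ⊕ A₂)}
    (h : IsWordHyperbolicWrt (freeProdHom π₁ π₂) R) (hR : blocks (R₁ - 1) (R₂ - 1) ≤ R)
    (h₂ : IsRegularCombing π₂ R₂) {e₁ : List A₁} (he₁ : e₁ ∈ R₁ - 1) (h1₁ : eval π₁ e₁ = 1) :
    IsWordHyperbolicWrt π₂ R₂∗ := by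
  have hle : blocks {e₁} (R₂ - 1) ≤ R :=
    (blocks_mono (Set.singleton_subset_iff.2 he₁) le_rfl).trans hR
  refine h.of_filterMap h₂.kstar
    (isRegular_blocks (isRegular_singleton e₁) h₂.regular.sub_one) hle
    (ι := Monoid.Coprod.inr) Monoid.Coprod.inr_injective Sum.getRight? ?_ ?_ ?_
  · intro k hk
    induction hk using blocks_induction with
    | nil => exact nil_mem_kstar _
    | append u hu v hv y _ ih =>
      rw [List.filterMap_append, filterMap_getRight_append]
      exact append_mem_kstar (mem_kstar_of_mem hv.1) ih
  · intro k hk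
    induction hk using blocks_induction with
    | nil => simp [eval_nil]
    | append u hu v hv y _ ih =>
      obtain rfl : u = e₁ := hu
      rw [List.filterMap_append, filterMap_getRight_append, eval_append, eval_append, eval_append,
        eval_freeProdHom_map_inl, eval_freeProdHom_map_inr, h1₁, map_one, one_mul, ih, map_mul]
  · intro u hu
    induction hu using kstar_induction with
    | nil => exact ⟨[], nil_mem_kstar _, rfl⟩
    | append x hx y _ ih =>
      obtain ⟨k, hk, rfl⟩ := ih
      rcases eq_or_ne x [] with rfl | hne
      · exact ⟨k, hk, rfl⟩
      · refine ⟨_, append_mem_kstar (block_mem_blocks rfl ⟨hx, hne⟩) hk, ?_⟩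
        rw [List.filterMap_append, filterMap_getRight_append]

end coprod

end WordHyp

theorem mainTheorem5 {M₁ M₂ : Type*} [Monoid M₁] [Monoid M₂]
    {A₁ A₂ : Type*} [Finite A₁] [Finite A₂]
    (π₁ : FreeMonoid A₁ →* M₁) (π₂ : FreeMonoid A₂ →* M₂)
    (R₁ : Language A₁) (R₂ : Language A₂) (R : Language (A₁ ⊕ A₂))
    (h₁ : WordHyp.IsWordHyperbolicWrt π₁ R₁) (hu₁ : ¬ WordHyp.OneUnique π₁ R₁)
    (h₂ : WordHyp.IsWordHyperbolicWrt π₂ R₂) (hu₂ : ¬ WordHyp.OneUnique π₂ R₂)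
    (h : WordHyp.IsWordHyperbolicWrt (WordHyp.freeProdHom π₁ π₂) R)
    (hR : WordHyp.alt R₁ R₂ ≤ R) :
    WordHyp.IsStarWordHyperbolic M₁ ∧ WordHyp.IsStarWordHyperbolic M₂ ∧
      WordHyp.IsStarWordHyperbolic (Monoid.Coprod M₁ M₂) := by
  obtain ⟨e₁, he₁, hne₁, h1₁⟩ := WordHyp.exists_ne_nil_eval_eq_one h₁.combing hu₁
  obtain ⟨e₂, he₂, hne₂, h1₂⟩ := WordHyp.exists_ne_nil_eval_eq_one h₂.combing hu₂
  have hle := WordHyp.blocks_le_alt.trans hR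
  refine ⟨?_, ?_, ?_⟩
  · exact (WordHyp.isWordHyperbolicWrt_kstar_left h hle h₁.combing ⟨he₂, hne₂⟩
      h1₂).isStarWordHyperbolic (kstar_idem R₁)
  · exact (WordHyp.isWordHyperbolicWrt_kstar_right h hle h₂.combing ⟨he₁, hne₁⟩
      h1₁).isStarWordHyperbolic (kstar_idem R₂)
  · exact (h.mono hle (WordHyp.isRegularCombing_blocks h₁.combing
      h₂.combing ⟨he₁, hne₁⟩ h1₁ ⟨he₂, hne₂⟩ h1₂)).isStarWordHyperbolic (kstar_idem _)
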